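/- **Theorem (Handelman).** Let $n\in\mathbb N$ and $\mathbb R[X]=\mathbb R[X_1,\dots,X_n]$ with quotient field $\mathbb R(X)$. Let $0\neq g\in\mathbb R[X]$ have only nonnegative coefficients. Put $\mathbb R[X]_g=\mathbb R[X,1/g]\subset\mathbb R(X)$, and let $T_g\subset\mathbb R[X]_g$ be the semiring (subset containing $0$ and $1$, closed under addition and multiplication) generated by $1/g$ and all polynomials with only nonnegative coefficients. Let $$A(g)=\{a\in\mathbb R[X]_g\mid N+a\in T_g\text{ and }N-a\in T_g\text{ for some }N\in\mathbb N\},$$ which is a subring of $\mathbb R[X]_g$, let $T(g)=T_g\cap A(g)$, and let $S(T(g))$ be the set of all (unital) ring homomorphisms $x:A(g)\to\mathbb R$ with $x(t)\ge 0$ for all $t\in T(g)$; write $a(x):=x(a)$. For $w\in\mathbb R^n$ let $v_w:\mathbb R(X)\to\mathbb R\cup\{\infty\}$ be the valuation with $v_w(p)=-\max\{\langle w,\alpha\rangle\mid X^\alpha\text{ has nonzero coefficient in }p\}$ for $0\ne p\in\mathbb R[X]$, let $\mathcal O_w$ be its valuation ring, and for $p\in\mathbb R[X]$ let $\mathrm{in}_w(p)$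 be the sum of those monomials (with coefficient) of $p$ for whose exponent $\alpha$ the number $\langle w,\alpha\rangle$ is maximal. Let $\lambda_w:\mathcal O_w\to\mathbb R(X)$ be the ring homomorphism with $$\lambda_w\left(\frac pq\right)=\begin{cases}0&\text{if }v_w(p)>v_w(q),\\ \mathrm{in}_w(p)/\mathrm{in}_w(q)&\text{if }v_w(p)=v_w(q)\end{cases}\qquad(p,q\in\mathbb R[X],\ q\ne0,\ v_w(p)\ge v_w(q)).$$ Then for every $x\in S(T(g))$ there are $w\in\mathbb R^n$ and $y\in(0,\infty)^n$ such that, for all $a\in A(g)$, we have $a\in\mathcal O_w$, the rational function $\lambda_w(a)$ is defined at $y$ (that is, it can be written as $p/q$ with $p,q\in\mathbb R[X]$ and $q(y)\neq0$), and $$a(x)=\lambda_w(a)(y).$$ -/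

import Mathlib

namespace Handelman

section Semirings

variable {A : Type*} [CommRing A]

/-- The ring `O_T(A)` of `T`-bounded elements of `A`: those `a` with `N + a ∈ T` and `N - a ∈ T`
for some natural number `N`. A semiring of the ring `A` is a subset containing `0` and `1` that is
closed under addition and multiplication, that is, a `Subsemiring A`. -/
def boundedSubring (T : Subsemiring A) : Subring A where
  carrier := {a | ∃ N : ℕ, (N : A) + a ∈ T ∧ (N : A) - a ∈ T}
  zero_mem' := ⟨0, by simp, by simp⟩
  one_mem' := ⟨1, by
    have h := T.add_mem T.one_mem T.one_mem
    exact ⟨by simpa using h, by simp⟩⟩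
  neg_mem' := by
    rintro a ⟨N, h1, h2⟩
    exact ⟨N, by simpa [sub_eq_add_neg] using h2, by simpa using h1⟩
  add_mem' := by
    rintro a b ⟨N, h1, h2⟩ ⟨M, h3, h4⟩
    refine ⟨N + M, ?_, ?_⟩
    · have h := T.add_mem h1 h3
      have e : ((N + M : ℕ) : A) + (a + b) = (N + a) + (M + b) := by push_cast; ring
      rwa [e]
    · have h := T.add_mem h2 h4
      have e : ((N + M : ℕ) : A) - (a + b) = (N - a) + (M - b) := by push_cast; ring
      rwa [e]
  mul_mem' := by
    rintro a b ⟨N, h1, h2⟩ ⟨M, h3, h4⟩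
    have hN := natCast_mem T N
    have hM := natCast_mem T M
    refine ⟨3 * N * M, ?_, ?_⟩
    · have h := T.add_mem (T.add_mem (T.mul_mem h1 h3) (T.mul_mem hM h2)) (T.mul_mem hN h4)
      have e : ((3 * N * M : ℕ) : A) + a * b
          = (N + a) * (M + b) + M * (N - a) + N * (M - b) := by push_cast; ring
      rwa [e]
    · have h := T.add_mem (T.add_mem (T.mul_mem h2 h3) (T.mul_mem hM h1)) (T.mul_mem hN h4)
      have e : ((3 * N * M : ℕ) : A) - a * b
          = (N - a) * (M + b) + M * (N + a) + N * (M - b) := by push_cast; ring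
      rwa [e]

/-- The space `S(T)` of all (unital) ring homomorphisms `A → ℝ` that are nonnegative on `T`. -/
def realPoints (T : Subsemiring A) : Set (A →+* ℝ) :=
  {φ | ∀ t ∈ T, 0 ≤ φ t}

end Semirings

noncomputable section

variable {n : ℕ}

/-- The field `ℝ(X₁, …, Xₙ)`, the quotient field of `ℝ[X₁, …, Xₙ]`. -/
abbrev RatFun (n : ℕ) : Type := FractionRing (MvPolynomial (Fin n) ℝ)

/-- A polynomial as a rational function. -/
abbrev toRat : MvPolynomial (Fin n) ℝ →+* RatFun n :=
  algebraMap (MvPolynomial (Fin n) ℝ) (RatFun n)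

/-- The set `ℝ_{≥0}[X]` of polynomials all of whose coefficients are nonnegative. -/
def nonnegPolys (n : ℕ) : Set (MvPolynomial (Fin n) ℝ) :=
  {p | ∀ α, 0 ≤ p.coeff α}

/-- The ring `ℝ[X]_g = ℝ[X, 1/g]`, as a subring of `ℝ(X)`. -/
def localizedRing (g : MvPolynomial (Fin n) ℝ) : Subring (RatFun n) :=
  Subring.closure (Set.range toRat ∪ {(toRat g)⁻¹})

/-- The semiring `T_g` of `ℝ[X]_g` generated by `ℝ_{≥0}[X]` and `1/g`. -/
def localizedSemiring (g : MvPolynomial (Fin n) ℝ) : Subsemiring (localizedRing g) :=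
  Subsemiring.closure
    {t | (∃ f ∈ nonnegPolys n, (t : RatFun n) = toRat f) ∨ (t : RatFun n) = (toRat g)⁻¹}

/-- The ring `A(g)` of `T_g`-bounded elements of `ℝ[X]_g`. -/
def boundedRing (g : MvPolynomial (Fin n) ℝ) : Subring (localizedRing g) :=
  boundedSubring (localizedSemiring g)

/-- The semiring `T(g) = T_g ∩ A(g)` of `A(g)`. -/
def boundedSemiring (g : MvPolynomial (Fin n) ℝ) : Subsemiring (boundedRing g) :=
  (localizedSemiring g).comap (boundedRing g).subtype

/-- The scalar product `⟨w, α⟩` of a real vector and an exponent tuple. -/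
def dot (w : Fin n → ℝ) (α : Fin n →₀ ℕ) : ℝ := ∑ i, w i * (α i : ℝ)

/-- `v_w` on polynomials: `v_w(p) = -max {⟨w, α⟩ | α ∈ Log(p)}`, written as the minimum of the
`-⟨w, α⟩` over the exponents `α` occurring in `p`, with value `∞` if `p = 0`. -/
def polyVal (w : Fin n → ℝ) (p : MvPolynomial (Fin n) ℝ) : WithTop ℝ :=
  p.support.inf fun α => ((-dot w α : ℝ) : WithTop ℝ)

open Classical in
/-- The `w`-initial part `in_w(p)`: the sum of those monomials of `p` for whose exponent `α`
the number `⟨w, α⟩` is maximal. -/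
def initialPart (w : Fin n → ℝ) (p : MvPolynomial (Fin n) ℝ) : MvPolynomial (Fin n) ℝ :=
  ∑ α ∈ p.support with ∀ β ∈ p.support, dot w β ≤ dot w α, MvPolynomial.monomial α (p.coeff α)

open Classical in
/-- The part of `p` of weight `d` (auxiliary). -/
def weightPart (w : Fin n → ℝ) (d : ℝ) (p : MvPolynomial (Fin n) ℝ) : MvPolynomial (Fin n) ℝ :=
  ∑ α ∈ p.support with dot w α = d, MvPolynomial.monomial α (p.coeff α)

theorem dot_add (w : Fin n → ℝ) (α β : Fin n →₀ ℕ) : dot w (α + β) = dot w α + dot w β := by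
  simp [dot, mul_add, Finset.sum_add_distrib]

open Classical in
theorem coeff_weightPart (w : Fin n → ℝ) (d : ℝ) (p : MvPolynomial (Fin n) ℝ) (γ : Fin n →₀ ℕ) :
    (weightPart w d p).coeff γ = if dot w γ = d then p.coeff γ else 0 := by
  rw [weightPart, MvPolynomial.coeff_sum]
  simp only [MvPolynomial.coeff_monomial]
  rw [Finset.sum_ite_eq']
  by_cases h : dot w γ = d <;> by_cases h' : p.coeff γ = 0 <;> simp [h, h']

theorem weightPart_add (w : Fin n → ℝ) (d : ℝ) (p q : MvPolynomial (Fin n) ℝ) :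
    weightPart w d (p + q) = weightPart w d p + weightPart w d q := by
  classical
  ext γ
  simp only [MvPolynomial.coeff_add, coeff_weightPart]
  split_ifs <;> simp

theorem le_polyVal_iff (w : Fin n → ℝ) (d : ℝ) (p : MvPolynomial (Fin n) ℝ) :
    ((-d : ℝ) : WithTop ℝ) ≤ polyVal w p ↔ ∀ α, p.coeff α ≠ 0 → dot w α ≤ d := by
  rw [polyVal, Finset.le_inf_iff]
  refine forall_congr' fun α => ?_
  rw [MvPolynomial.mem_support_iff, WithTop.coe_le_coe, neg_le_neg_iff]

theorem polyVal_zero (w : Fin n → ℝ) : polyVal w 0 = ⊤ := by simp [polyVal]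

theorem exists_polyVal (w : Fin n → ℝ) {p : MvPolynomial (Fin n) ℝ} (hp : p ≠ 0) :
    ∃ d : ℝ, polyVal w p = ((-d : ℝ) : WithTop ℝ) ∧ weightPart w d p = initialPart w p ∧
      weightPart w d p ≠ 0 := by
  classical
  obtain ⟨α, hα, h⟩ := p.support.exists_max_image (dot w) (MvPolynomial.support_nonempty.2 hp)
  refine ⟨dot w α, le_antisymm (Finset.inf_le hα) ?_, ?_, ?_⟩
  · rw [le_polyVal_iff]
    exact fun β hβ => h β (MvPolynomial.mem_support_iff.2 hβ)
  · refine Finset.sum_congr (Finset.filter_congr fun β hβ => ?_) fun _ _ => rfl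
    exact ⟨fun e γ hγ => e ▸ h γ hγ, fun e => le_antisymm (h β hβ) (e α hα)⟩
  · intro h0
    have := coeff_weightPart w (dot w α) p α
    rw [h0, if_pos rfl] at this
    exact MvPolynomial.mem_support_iff.1 hα (by simpa using this.symm)

theorem weightPart_eq_zero (w : Fin n → ℝ) {d : ℝ} {p : MvPolynomial (Fin n) ℝ}
    (h : ((-d : ℝ) : WithTop ℝ) < polyVal w p) : weightPart w d p = 0 := by
  classical
  ext γ
  rw [coeff_weightPart, MvPolynomial.coeff_zero]
  split_ifs with hd
  · by_contra hγ
    have h1 : polyVal w p ≤ ((-dot w γ : ℝ) : WithTop ℝ) :=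
      Finset.inf_le (MvPolynomial.mem_support_iff.2 hγ)
    rw [hd] at h1
    exact absurd (h.trans_le h1) (lt_irrefl _)
  · rfl

theorem polyVal_eq_of (w : Fin n → ℝ) {d : ℝ} {p : MvPolynomial (Fin n) ℝ}
    (h : ((-d : ℝ) : WithTop ℝ) ≤ polyVal w p) (h0 : weightPart w d p ≠ 0) :
    polyVal w p = ((-d : ℝ) : WithTop ℝ) :=
  (h.eq_or_lt.resolve_right fun h' => h0 (weightPart_eq_zero w h')).symm

theorem weightPart_mul (w : Fin n → ℝ) {d e : ℝ} {p q : MvPolynomial (Fin n) ℝ}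
    (hp : ((-d : ℝ) : WithTop ℝ) ≤ polyVal w p) (hq : ((-e : ℝ) : WithTop ℝ) ≤ polyVal w q) :
    weightPart w (d + e) (p * q) = weightPart w d p * weightPart w e q := by
  classical
  rw [le_polyVal_iff] at hp hq
  ext γ
  rw [coeff_weightPart, MvPolynomial.coeff_mul, MvPolynomial.coeff_mul]
  simp only [coeff_weightPart]
  split_ifs with h
  · refine Finset.sum_congr rfl fun x hx => ?_
    have hs : dot w x.1 + dot w x.2 = d + e := by
      rw [← dot_add, Finset.HasAntidiagonal.mem_antidiagonal.1 hx, h]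
    by_cases h1 : p.coeff x.1 = 0
    · simp [h1]
    by_cases h2 : q.coeff x.2 = 0
    · simp [h2]
    have := hp _ h1
    have := hq _ h2
    rw [if_pos (by linarith), if_pos (by linarith)]
  · refine (Finset.sum_eq_zero fun x hx => ?_).symm
    by_cases h1 : dot w x.1 = d
    · have h2 : dot w x.2 ≠ e := fun h2 => h (by
        rw [← Finset.HasAntidiagonal.mem_antidiagonal.1 hx, dot_add, h1, h2])
      simp [h2]
    · simp [h1]

theorem le_polyVal_mul (w : Fin n → ℝ) {d e : ℝ} {p q : MvPolynomial (Fin n) ℝ}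
    (hp : ((-d : ℝ) : WithTop ℝ) ≤ polyVal w p) (hq : ((-e : ℝ) : WithTop ℝ) ≤ polyVal w q) :
    ((-(d + e) : ℝ) : WithTop ℝ) ≤ polyVal w (p * q) := by
  classical
  rw [le_polyVal_iff] at hp hq ⊢
  intro γ hγ
  rw [MvPolynomial.coeff_mul] at hγ
  obtain ⟨x, hx, h⟩ := Finset.exists_ne_zero_of_sum_ne_zero hγ
  rw [← Finset.HasAntidiagonal.mem_antidiagonal.1 hx, dot_add]
  exact add_le_add (hp _ (left_ne_zero_of_mul h)) (hq _ (right_ne_zero_of_mul h))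

theorem polyVal_mul (w : Fin n → ℝ) (p q : MvPolynomial (Fin n) ℝ) :
    polyVal w (p * q) = polyVal w p + polyVal w q := by
  by_cases hp : p = 0
  · simp [hp, polyVal_zero]
  by_cases hq : q = 0
  · simp [hq, polyVal_zero]
  obtain ⟨d, hd, -, hd0⟩ := exists_polyVal w hp
  obtain ⟨e, he, -, he0⟩ := exists_polyVal w hq
  rw [polyVal_eq_of w (le_polyVal_mul w hd.ge he.ge)
    (by rw [weightPart_mul w hd.ge he.ge]; exact mul_ne_zero hd0 he0), hd, he, neg_add,
    WithTop.coe_add]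

theorem le_polyVal_add (w : Fin n → ℝ) (p q : MvPolynomial (Fin n) ℝ) :
    min (polyVal w p) (polyVal w q) ≤ polyVal w (p + q) := by
  refine Finset.le_inf fun α hα => ?_
  by_cases h : p.coeff α = 0
  · refine min_le_of_right_le (Finset.inf_le (MvPolynomial.mem_support_iff.2 fun h' => ?_))
    exact MvPolynomial.mem_support_iff.1 hα (by simp [h, h'])
  · exact min_le_of_left_le (Finset.inf_le (MvPolynomial.mem_support_iff.2 h))

theorem polyVal_one (w : Fin n → ℝ) : polyVal w 1 = 0 := by
  have h : (1 : MvPolynomial (Fin n) ℝ).support = {0} := by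
    ext α
    simp
  simp [polyVal, h, dot]

/-- `v_w` as a valuation of the polynomial ring. -/
def polyValuation (w : Fin n → ℝ) : AddValuation (MvPolynomial (Fin n) ℝ) (WithTop ℝ) :=
  AddValuation.of (polyVal w) (polyVal_zero w) (polyVal_one w) (le_polyVal_add w) (polyVal_mul w)

theorem nonZeroDivisors_le (w : Fin n → ℝ) :
    nonZeroDivisors (MvPolynomial (Fin n) ℝ) ≤
      (AddValuation.toValuation (polyValuation w)).supp.primeCompl := by
  intro p hp h
  have h' : polyVal w p = ⊤ := h
  obtain ⟨d, hd, -⟩ := exists_polyVal w (nonZeroDivisors.ne_zero hp)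
  rw [hd] at h'
  exact WithTop.coe_ne_top h'

/-- The valuation `v_w : ℝ(X) → ℝ ∪ {∞}`, the extension of `polyVal w` to the quotient field. -/
def monomialValuation (w : Fin n → ℝ) : AddValuation (RatFun n) (WithTop ℝ) :=
  AddValuation.ofValuation
    ((AddValuation.toValuation (polyValuation w)).extendToLocalization
      (nonZeroDivisors_le w) (RatFun n))

theorem monomialValuation_toRat (w : Fin n → ℝ) (p : MvPolynomial (Fin n) ℝ) :
    monomialValuation w (toRat p) = polyVal w p :=
  Valuation.extendToLocalization_apply_map_apply
    (AddValuation.toValuation (polyValuation w)) (nonZeroDivisors_le w) (RatFun n) p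

/-- The valuation ring `O_w` of `v_w`. -/
def valuationRing (w : Fin n → ℝ) : ValuationSubring (RatFun n) :=
  (AddValuation.toValuation (monomialValuation w)).valuationSubring

theorem mem_valuationRing (w : Fin n → ℝ) (a : RatFun n) :
    a ∈ valuationRing w ↔ 0 ≤ monomialValuation w a :=
  Iff.rfl

theorem toRat_ne_zero {q : MvPolynomial (Fin n) ℝ} (hq : q ≠ 0) : toRat q ≠ 0 := by
  simpa using hq

theorem div_mem_valuationRing (w : Fin n → ℝ) (p : MvPolynomial (Fin n) ℝ)
    {q : MvPolynomial (Fin n) ℝ} (hq : q ≠ 0) :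
    toRat p / toRat q ∈ valuationRing w ↔ polyVal w q ≤ polyVal w p := by
  rw [mem_valuationRing]
  have h : monomialValuation w (toRat p) =
      monomialValuation w (toRat p / toRat q) + monomialValuation w (toRat q) := by
    rw [← AddValuation.map_mul, div_mul_cancel₀ _ (toRat_ne_zero hq)]
  rw [monomialValuation_toRat, monomialValuation_toRat] at h
  obtain ⟨d, hd, -⟩ := exists_polyVal w hq
  rw [h, hd]
  generalize monomialValuation w (toRat p / toRat q) = t
  induction t using WithTop.recTopCoe with
  | top => simp
  | coe t => norm_cast; constructor <;> intro h <;> linarith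

open Classical in
/-- The right-hand side of the formula defining `λ_w(p/q)`. -/
def placeFormula (w : Fin n → ℝ) (p q : MvPolynomial (Fin n) ℝ) : RatFun n :=
  if polyVal w q < polyVal w p then 0 else toRat (initialPart w p) / toRat (initialPart w q)

theorem placeFormula_eq (w : Fin n → ℝ) {p q : MvPolynomial (Fin n) ℝ} {e : ℝ}
    (hq : polyVal w q = ((-e : ℝ) : WithTop ℝ)) (h : polyVal w q ≤ polyVal w p) :
    placeFormula w p q = toRat (weightPart w e p) / toRat (weightPart w e q) := by
  have key : ∀ r : MvPolynomial (Fin n) ℝ, polyVal w r = ((-e : ℝ) : WithTop ℝ) →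
      initialPart w r = weightPart w e r := by
    intro r hr
    have hr0 : r ≠ 0 := by
      rintro rfl
      rw [polyVal_zero] at hr
      exact WithTop.top_ne_coe hr
    obtain ⟨d, hd, h1, -⟩ := exists_polyVal w hr0
    have : d = e := by
      rw [hr] at hd
      have := WithTop.coe_injective hd
      linarith
    rw [← h1, this]
  unfold placeFormula
  split_ifs with h'
  · rw [weightPart_eq_zero w (hq ▸ h'), map_zero, zero_div]
  · rw [key q hq, key p ((le_antisymm (not_lt.1 h') h).trans hq)]

theorem placeFormula_congr (w : Fin n → ℝ) {p q p' q' : MvPolynomial (Fin n) ℝ}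
    (hq : q ≠ 0) (hq' : q' ≠ 0) (h : polyVal w q ≤ polyVal w p)
    (e : toRat p / toRat q = toRat p' / toRat q') :
    placeFormula w p q = placeFormula w p' q' := by
  have h' : polyVal w q' ≤ polyVal w p' := by
    rwa [← div_mem_valuationRing w _ hq', ← e, div_mem_valuationRing w _ hq]
  obtain ⟨d, hd, -, hd0⟩ := exists_polyVal w hq
  obtain ⟨d', hd', -, hd0'⟩ := exists_polyVal w hq'
  rw [placeFormula_eq w hd h, placeFormula_eq w hd' h',
    div_eq_div_iff (toRat_ne_zero hd0) (toRat_ne_zero hd0')]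
  rw [div_eq_div_iff (toRat_ne_zero hq) (toRat_ne_zero hq'), ← map_mul, ← map_mul] at e
  have e' := IsFractionRing.injective (MvPolynomial (Fin n) ℝ) (RatFun n) e
  rw [← map_mul, ← map_mul, ← weightPart_mul w (hd ▸ h) hd'.ge, e', add_comm,
    weightPart_mul w (hd' ▸ h') hd.ge]

/-- `λ_w(p/q) = 0` if `v_w(p) > v_w(q)`, and `λ_w(p/q) = in_w(p)/in_w(q)` if `v_w(p) = v_w(q)`,
evaluated at a chosen numerator and denominator; on `O_w` the choice is irrelevant. -/
def placeFun (w : Fin n → ℝ) (a : RatFun n) : RatFun n :=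
  placeFormula w (IsLocalization.sec (nonZeroDivisors (MvPolynomial (Fin n) ℝ)) a).1
    (IsLocalization.sec (nonZeroDivisors (MvPolynomial (Fin n) ℝ)) a).2

theorem placeFun_div (w : Fin n → ℝ) {p q : MvPolynomial (Fin n) ℝ}
    (hq : q ≠ 0) (h : polyVal w q ≤ polyVal w p) :
    placeFun w (toRat p / toRat q) = placeFormula w p q := by
  have hs := IsLocalization.sec_spec (nonZeroDivisors (MvPolynomial (Fin n) ℝ))
    (toRat p / toRat q : RatFun n)
  have h0 : ((IsLocalization.sec (nonZeroDivisors (MvPolynomial (Fin n) ℝ))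
    (toRat p / toRat q : RatFun n)).2 : MvPolynomial (Fin n) ℝ) ≠ 0 := nonZeroDivisors.coe_ne_zero _
  exact (placeFormula_congr w hq h0 h ((eq_div_iff (toRat_ne_zero h0)).2 hs)).symm

theorem exists_common (a b : RatFun n) : ∃ p p' q : MvPolynomial (Fin n) ℝ, q ≠ 0 ∧
    a = toRat p / toRat q ∧ b = toRat p' / toRat q := by
  obtain ⟨p, q, hq, rfl⟩ := IsFractionRing.div_surjective (A := MvPolynomial (Fin n) ℝ) a
  obtain ⟨p', q', hq', rfl⟩ := IsFractionRing.div_surjective (A := MvPolynomial (Fin n) ℝ) b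
  have h := toRat_ne_zero (nonZeroDivisors.ne_zero hq)
  have h' := toRat_ne_zero (nonZeroDivisors.ne_zero hq')
  refine ⟨p * q', p' * q, q * q',
    mul_ne_zero (nonZeroDivisors.ne_zero hq) (nonZeroDivisors.ne_zero hq'), ?_, ?_⟩
  · rw [map_mul, map_mul, mul_div_mul_right _ _ h']
  · rw [map_mul, map_mul, mul_comm (toRat q), mul_div_mul_right _ _ h]

/-- The place `λ_w : O_w → ℝ(X)` attached to `v_w`. -/
def place (w : Fin n → ℝ) : valuationRing w →+* RatFun n where
  toFun a := placeFun w a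
  map_zero' := by
    have h : polyVal w 1 ≤ polyVal w (0 : MvPolynomial (Fin n) ℝ) := by simp [polyVal_zero]
    have := placeFun_div w one_ne_zero h
    simpa [placeFormula, polyVal_zero, polyVal_one] using this
  map_one' := by
    have := placeFun_div w (p := 1) (q := 1) one_ne_zero le_rfl
    obtain ⟨d, -, h1, h2⟩ := exists_polyVal w (one_ne_zero (α := MvPolynomial (Fin n) ℝ))
    rw [h1] at h2
    simpa [placeFormula, div_self (toRat_ne_zero h2)] using this
  map_add' := by
    rintro ⟨a, ha⟩ ⟨b, hb⟩
    obtain ⟨p, p', q, hq, rfl, rfl⟩ := exists_common a b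
    rw [div_mem_valuationRing w _ hq] at ha hb
    obtain ⟨e, he, -, he0⟩ := exists_polyVal w hq
    have hs : polyVal w q ≤ polyVal w (p + p') := (le_min ha hb).trans (le_polyVal_add w p p')
    change placeFun w (toRat p / toRat q + toRat p' / toRat q) =
      placeFun w (toRat p / toRat q) + placeFun w (toRat p' / toRat q)
    rw [← add_div, ← map_add, placeFun_div w hq ha, placeFun_div w hq hb, placeFun_div w hq hs,
      placeFormula_eq w he ha, placeFormula_eq w he hb, placeFormula_eq w he hs,
      weightPart_add, map_add, add_div]
  map_mul' := by
    rintro ⟨a, ha⟩ ⟨b, hb⟩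
    obtain ⟨p, p', q, hq, rfl, rfl⟩ := exists_common a b
    rw [div_mem_valuationRing w _ hq] at ha hb
    obtain ⟨e, he, -, he0⟩ := exists_polyVal w hq
    have hs : polyVal w (q * q) ≤ polyVal w (p * p') := by
      rw [polyVal_mul, polyVal_mul]
      exact add_le_add ha hb
    have he2 : polyVal w (q * q) = ((-(e + e) : ℝ) : WithTop ℝ) := by
      rw [polyVal_mul, he, neg_add, WithTop.coe_add]
    change placeFun w (toRat p / toRat q * (toRat p' / toRat q)) =
      placeFun w (toRat p / toRat q) * placeFun w (toRat p' / toRat q)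
    rw [div_mul_div_comm, ← map_mul, ← map_mul, placeFun_div w hq ha, placeFun_div w hq hb,
      placeFun_div w (mul_ne_zero hq hq) hs,
      placeFormula_eq w he ha, placeFormula_eq w he hb, placeFormula_eq w he2 hs,
      weightPart_mul w (he ▸ ha) (he ▸ hb), weightPart_mul w he.ge he.ge, map_mul, map_mul,
      div_mul_div_comm]

/-- The formula for `λ_w(p/q)`, for every representation of an element of `O_w` as `p/q`. -/
theorem place_div (w : Fin n → ℝ) {p q : MvPolynomial (Fin n) ℝ} (hq : q ≠ 0)
    (h : toRat p / toRat q ∈ valuationRing w) :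
    place w ⟨toRat p / toRat q, h⟩ = placeFormula w p q :=
  placeFun_div w hq ((div_mem_valuationRing w p hq).1 h)

/-- The rational function `r` is defined at the point `y ∈ ℝⁿ` with value `r(y) = c`: it can be
written as `p/q` with `q(y) ≠ 0`, and `c = p(y)/q(y)`. -/
def HasValueAt (r : RatFun n) (y : Fin n → ℝ) (c : ℝ) : Prop :=
  ∃ p q : MvPolynomial (Fin n) ℝ, MvPolynomial.eval y q ≠ 0 ∧ r = toRat p / toRat q ∧
    c = MvPolynomial.eval y p / MvPolynomial.eval y q

/-- The value of a rational function at a point is unique. -/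
theorem HasValueAt.unique {r : RatFun n} {y : Fin n → ℝ} {c c' : ℝ}
    (h : HasValueAt r y c) (h' : HasValueAt r y c') : c = c' := by
  obtain ⟨p, q, hq, hr, rfl⟩ := h
  obtain ⟨p', q', hq', hr', rfl⟩ := h'
  have h0 : q ≠ 0 := by rintro rfl; simp at hq
  have h0' : q' ≠ 0 := by rintro rfl; simp at hq'
  rw [hr, div_eq_div_iff (toRat_ne_zero h0) (toRat_ne_zero h0'), ← map_mul, ← map_mul] at hr'
  have e := congrArg (MvPolynomial.eval y)
    (IsFractionRing.injective (MvPolynomial (Fin n) ℝ) (RatFun n) hr')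
  rw [map_mul, map_mul] at e
  rw [div_eq_div_iff hq hq', e]

end

end Handelman

/-!
The ring `A(g)` is generated over `ℝ` by the finitely many fractions `u_α = X^α / g`, where `α` runs
through the exponents of `g` (`eq_top_of_generators_mem`). A point `x` of `S(T(g))` is the identity
on constants, so it is determined by the numbers `x(u_α) ≥ 0`. These inherit every multiplicative
relation of the `u_α`: if `∑ m_α α = ∑ m'_α α` and `∑ m_α = ∑ m'_α`, then
`∏ u_α ^ m_α = ∏ u_α ^ m'_α`.

The relations control both the zero pattern and the nonzero values (`exists_weight_and_point`). By
Gordan's theorem of the alternative over `ℚ`, either the set of `α` with `x(u_α) ≠ 0` is the set of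
exponents of `g` on which some weight `w` is maximal, or there is an integral relation in which some
`u_α` with `x(u_α) = 0` occurs on exactly one side, while the other side contains only factors on which
`x` is positive; the latter is absurd. On the maximal face, `log x(u_α)` respects all rational linear
relations between the `(α, 1)`, so it extends to a `ℚ`-linear map, and exponentiating gives
`x(u_α) = r y^α` with `y` and `r` positive. Since `∑ c_α u_α = 1` for the coefficients `c_α` of `g`,
necessarily `r = 1 / in_w(g)(y)`. Hence `x(u_α) = λ_w(u_α)(y)` for all `α`, and the elements `a` with
`x(a) = λ_w(a)(y)` form a subring, which is all of `A(g)`.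
-/

namespace Handelman

/-! ### Linear alternatives over an ordered field -/

section OrderedField

variable {ι K V U : Type*} [Field K] [AddCommGroup V] [Module K V] [AddCommGroup U] [Module K U]

/-- Gordan's theorem of the alternative over an ordered field, relative to a subspace `W`: if no
nontrivial nonnegative combination of the vectors `v i`, `i ∈ s`, lies in `W`, then some linear form
vanishes on `W` and is positive on all these vectors. -/
theorem exists_dual_pos_of_no_nonneg_combination [LinearOrder K] [IsStrictOrderedRing K]
    (v : ι → V) (s : Finset ι) (W : Submodule K V)
    (h : ∀ c : ι → K, (∀ i ∈ s, 0 ≤ c i) → ∑ i ∈ s, c i • v i ∈ W → ∀ i ∈ s, c i = 0) :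
    ∃ φ : V →ₗ[K] K, (∀ z ∈ W, φ z = 0) ∧ ∀ i ∈ s, 0 < φ (v i) := by
  classical
  induction s using Finset.induction_on generalizing W with
  | empty => exact ⟨0, by simp, by simp⟩
  | insert j s hj ih =>
    -- The hypothesis, with the coefficient `t` of the new vector `v j` separated.
    have extend : ∀ (c : ι → K) (t : K), (∀ i ∈ s, 0 ≤ c i) → 0 ≤ t →
        ∑ i ∈ s, c i • v i + t • v j ∈ W → t = 0 ∧ ∀ i ∈ s, c i = 0 := by
      intro c t hc ht hW
      have hne : ∀ i ∈ s, i ≠ j := fun i hi e => hj (e ▸ hi)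
      have := h (Function.update c j t) (fun i hi => ?_) ?_
      · refine ⟨by simpa using this j (Finset.mem_insert_self _ _), fun i hi => ?_⟩
        simpa [hne i hi] using this i (Finset.mem_insert_of_mem hi)
      · rcases Finset.mem_insert.1 hi with rfl | hi
        · simpa using ht
        · simpa [hne i hi] using hc i hi
      · rw [Finset.sum_insert hj, add_comm, Function.update_self]
        convert hW using 2
        exact Finset.sum_congr rfl fun i hi => by rw [Function.update_of_ne (hne i hi)]
    -- Either a form obtained modulo `v j` can be perturbed to become positive on `v j`, or `v j` is,
    -- modulo `W`, a nonnegative combination of the other vectors.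
    by_cases H : ∀ c : ι → K, (∀ i ∈ s, 0 ≤ c i) →
        ∑ i ∈ s, c i • v i ∈ W ⊔ K ∙ v j → ∀ i ∈ s, c i = 0
    · obtain ⟨φ, hφW, hφ⟩ := ih _ H
      have hvj : v j ∉ W := fun hv => one_ne_zero
        (extend 0 1 (by simp) zero_le_one (by simpa using hv)).1
      obtain ⟨f, hfj, hfW⟩ := Submodule.exists_le_ker_of_notMem hvj
      have hφj : φ (v j) = 0 :=
        hφW _ (Submodule.mem_sup_right (Submodule.mem_span_singleton_self _))
      obtain ⟨M, hM⟩ := Finset.exists_le (s.image fun i => -(f (v j))⁻¹ * f (v i) / φ (v i))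
      refine ⟨(f (v j))⁻¹ • f + (M + 1) • φ, fun z hz => ?_, fun i hi => ?_⟩
      · have h1 : f z = 0 := hfW hz
        simp [h1, hφW z (Submodule.mem_sup_left hz)]
      · rcases Finset.mem_insert.1 hi with rfl | hi
        · simp [hφj, hfj]
        · have h1 := hM _ (Finset.mem_image_of_mem _ hi)
          rw [div_le_iff₀ (hφ i hi)] at h1
          simp only [LinearMap.add_apply, LinearMap.smul_apply, smul_eq_mul]
          linarith [hφ i hi]
    · push Not at H
      obtain ⟨c, hc, hcW, i₀, hi₀, hne⟩ := H
      obtain ⟨z, hz, u, hu, hzu⟩ := Submodule.mem_sup.1 hcW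
      obtain ⟨t, rfl⟩ := Submodule.mem_span_singleton.1 hu
      obtain ⟨φ, hφW, hφ⟩ := ih W fun c hc hW =>
        (extend c 0 hc le_rfl (by simpa using hW)).2
      refine ⟨φ, hφW, fun i hi => ?_⟩
      rcases Finset.mem_insert.1 hi with rfl | hi
      · -- For `t ≤ 0`, moving `t • v j` to the other side gives a forbidden combination.
        have ht : 0 < t := by
          by_contra ht
          refine hne ((extend c (-t) hc (by linarith) ?_).2 i₀ hi₀)
          rw [← hzu]
          simpa using hz
        have hpos : 0 < φ (∑ i ∈ s, c i • v i) := by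
          simp only [map_sum, map_smul, smul_eq_mul]
          exact Finset.sum_pos' (fun k hk => mul_nonneg (hc k hk) (hφ k hk).le)
            ⟨i₀, hi₀, mul_pos (lt_of_le_of_ne (hc i₀ hi₀) hne.symm) (hφ i₀ hi₀)⟩
        rw [← hzu, map_add, hφW z hz, map_smul, smul_eq_mul, zero_add] at hpos
        exact (pos_iff_pos_of_mul_pos hpos).1 ht
      · exact hφ i hi

/-- A linear map with prescribed values on a family of vectors exists as soon as the prescribed
values satisfy every linear relation of the family. -/
theorem exists_linearMap_apply_eq [Fintype ι] (v : ι → V) (u : ι → U)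
    (h : ∀ c : ι → K, ∑ i, c i • v i = 0 → ∑ i, c i • u i = 0) :
    ∃ L : V →ₗ[K] U, ∀ i, L (v i) = u i := by
  classical
  let Φ := Fintype.linearCombination K v
  let ψ := Fintype.linearCombination K u
  obtain ⟨r, hr⟩ := Φ.rangeRestrict.exists_rightInverse_of_surjective
    (LinearMap.range_eq_top.2 Φ.surjective_rangeRestrict)
  obtain ⟨L, hL⟩ := LinearMap.exists_extend (ψ ∘ₗ r)
  refine ⟨L, fun i => ?_⟩
  have h1 : Φ (Pi.single i 1) = v i := by simp [Φ]
  have h2 : ψ (Pi.single i 1) = u i := by simp [ψ]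
  have h3 : L (Φ (Pi.single i 1)) = ψ (r (Φ.rangeRestrict (Pi.single i 1))) :=
    LinearMap.congr_fun hL (Φ.rangeRestrict (Pi.single i 1))
  have h4 : Φ (r (Φ.rangeRestrict (Pi.single i 1))) = Φ (Pi.single i 1) :=
    congrArg Subtype.val (LinearMap.congr_fun hr (Φ.rangeRestrict (Pi.single i 1)))
  have h5 : ψ (r (Φ.rangeRestrict (Pi.single i 1)) - Pi.single i 1) = 0 := by
    have : Φ (r (Φ.rangeRestrict (Pi.single i 1)) - Pi.single i 1) = 0 := by
      rw [map_sub, h4, sub_self]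
    simp only [Φ, ψ, Fintype.linearCombination_apply] at this ⊢
    exact h _ this
  rw [← h1, h3, ← h2]
  rwa [map_sub, sub_eq_zero] at h5

end OrderedField

/-! ### Nonnegative solutions of binomial equations -/

section ToricPoints

variable {n : ℕ} {ι : Type*} [Fintype ι]

/-- The exponent `α` as the point `(α, 1)` at height one, so that linear relations between the
`homogenize α` are the relations between exponents whose coefficients sum to zero. The scalars are
rational so that relations can be made integral. -/
def homogenize (α : Fin n →₀ ℕ) : (Fin n → ℚ) × ℚ := (fun j => (α j : ℚ), 1)

theorem linearMap_homogenize {U : Type*} [AddCommGroup U] [Module ℚ U]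
    (L : ((Fin n → ℚ) × ℚ) →ₗ[ℚ] U) (α : Fin n →₀ ℕ) :
    L (homogenize α) = ∑ j, (α j : ℚ) • L (Pi.single j 1, 0) + L (0, 1) := by
  have h : homogenize α
      = ∑ j, (α j : ℚ) • ((Pi.single j 1, 0) : (Fin n → ℚ) × ℚ) + (0, 1) := by
    ext k
    · simp [homogenize, Prod.fst_sum, Finset.sum_apply, Pi.single_apply]
    · simp [homogenize, Prod.snd_sum]
  rw [h, map_add, map_sum]
  simp_rw [map_smul]

theorem exists_nat_mul_eq_intCast (c : ι → ℚ) :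
    ∃ N : ℕ, 0 < N ∧ ∃ k : ι → ℤ, ∀ i, (k i : ℚ) = N * c i := by
  classical
  refine ⟨∏ i, (c i).den, Finset.prod_pos fun i _ => (c i).den_pos,
    fun i => (∏ j ∈ Finset.univ.erase i, ((c j).den : ℤ)) * (c i).num, fun i => ?_⟩
  rw [← Finset.mul_prod_erase _ _ (Finset.mem_univ i)]
  push_cast
  rw [mul_right_comm, Rat.den_mul_eq_num, mul_comm]

/-- A rational linear relation between the `(v i, 1)`, multiplied by a common denominator `N`, splits
into a positive and a negative part, hence gives a multiplicative relation between the `x i`. -/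
theorem prod_pow_toNat_eq_of_relation (v : ι → Fin n →₀ ℕ) (x : ι → ℝ)
    (hrel : ∀ m m' : ι → ℕ, ∑ i, m i = ∑ i, m' i → ∑ i, m i • v i = ∑ i, m' i • v i →
      ∏ i, x i ^ m i = ∏ i, x i ^ m' i)
    (c : ι → ℚ) (hc : ∑ i, c i • homogenize (v i) = 0) :
    ∃ N : ℕ, 0 < N ∧ ∃ k : ι → ℤ, (∀ i, (k i : ℚ) = N * c i) ∧
      ∏ i, x i ^ (k i).toNat = ∏ i, x i ^ (-k i).toNat := by
  obtain ⟨N, hN, k, hk⟩ := exists_nat_mul_eq_intCast c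
  refine ⟨N, hN, k, hk, hrel _ _ ?_ ?_⟩
  · have h := congrArg Prod.snd hc
    simp only [homogenize, Prod.snd_sum, Prod.smul_mk, smul_eq_mul, mul_one, Prod.snd_zero] at h
    have h' : ∑ i, k i = 0 := by
      have : ((∑ i, k i : ℤ) : ℚ) = 0 := by
        push_cast
        simp_rw [hk, ← Finset.mul_sum, h, mul_zero]
      exact_mod_cast this
    have h2 : ∑ i, (((k i).toNat : ℤ) - ((-k i).toNat : ℤ)) = 0 := by
      simpa only [Int.toNat_sub_toNat_neg] using h'
    rw [Finset.sum_sub_distrib, sub_eq_zero] at h2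
    exact_mod_cast h2
  · ext j
    have h := congrFun (congrArg Prod.fst hc) j
    simp only [homogenize, Prod.fst_sum, Prod.smul_mk, Finset.sum_apply, Pi.smul_apply,
      smul_eq_mul, Prod.fst_zero, Pi.zero_apply] at h
    have h' : ∑ i, k i * (v i j : ℤ) = 0 := by
      have : ((∑ i, k i * (v i j : ℤ) : ℤ) : ℚ) = 0 := by
        push_cast
        simp_rw [hk, mul_assoc, ← Finset.mul_sum, h, mul_zero]
      exact_mod_cast this
    have h2 : ∑ i, (((k i).toNat : ℤ) * v i j - ((-k i).toNat : ℤ) * v i j) = 0 := by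
      simpa only [← sub_mul, Int.toNat_sub_toNat_neg] using h'
    rw [Finset.sum_sub_distrib, sub_eq_zero] at h2
    simp only [Finsupp.coe_finsetSum, Finset.sum_apply, Finsupp.smul_apply, smul_eq_mul]
    exact_mod_cast h2

/-- A nonnegative solution `x` of the homogeneous binomial equations given by the exponents `v i` is
supported on the exponents of weight `d` for some weight vector `w`, all other exponents having smaller
weight, and on this face it has the parametrization `x i = r * y ^ v i` with a positive point `y`. -/
theorem exists_weight_and_point (v : ι → Fin n →₀ ℕ) (x : ι → ℝ) (hx : ∀ i, 0 ≤ x i)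
    (hrel : ∀ m m' : ι → ℕ, ∑ i, m i = ∑ i, m' i → ∑ i, m i • v i = ∑ i, m' i • v i →
      ∏ i, x i ^ m i = ∏ i, x i ^ m' i) :
    ∃ (w : Fin n → ℝ) (d : ℝ) (y : Fin n → ℝ) (r : ℝ), (∀ j, 0 < y j) ∧ 0 < r ∧
      ∀ i, (x i = 0 → dot w (v i) < d) ∧
        (x i ≠ 0 → dot w (v i) = d ∧ x i = r * ∏ j, y j ^ v i j) := by
  classical
  let W : Submodule ℚ ((Fin n → ℚ) × ℚ) :=
    Submodule.span ℚ (Set.range fun i : {i // x i ≠ 0} => homogenize (v i))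
  -- The linear form comes from the alternative modulo the support `{i | x i ≠ 0}`: a forbidden
  -- relation would equate a product with a factor zero and a product of nonzero factors.
  obtain ⟨φ, hφW, hφ⟩ := exists_dual_pos_of_no_nonneg_combination (fun i => homogenize (v i))
    (Finset.univ.filter fun i => x i = 0) W (by
      intro c hc hcW i₀ hi₀
      obtain ⟨b, hb⟩ := (Submodule.mem_span_range_iff_exists_fun ℚ).1 hcW
      let e : ι → ℚ := fun i => if hi : x i ≠ 0 then -b ⟨i, hi⟩ else c i
      have he : ∑ i, e i • homogenize (v i) = 0 := by
        have e1 : ∀ i : {i // x i ≠ 0}, e i = -b i := fun i => dif_pos i.2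
        have e2 : ∀ i : {i // ¬ x i ≠ 0}, e i = c i := fun i => dif_neg i.2
        rw [← Fintype.sum_subtype_add_sum_subtype (fun i => x i ≠ 0)]
        simp only [e1, e2, neg_smul, Finset.sum_neg_distrib]
        rw [hb, neg_add_eq_zero]
        exact Finset.sum_subtype _ (by simp) _
      obtain ⟨N, hN, k, hk, hprod⟩ := prod_pow_toNat_eq_of_relation v x hrel e he
      have hN' : (0 : ℚ) < N := by exact_mod_cast hN
      have hz : ∀ i, x i = 0 → (k i : ℚ) = N * c i := fun i hi => by simp [hk, e, hi]
      by_contra hne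
      have hxi := (Finset.mem_filter.1 hi₀).2
      have hki : 0 < k i₀ := by
        have : (0 : ℚ) < k i₀ := by
          rw [hz _ hxi]
          exact mul_pos hN' (lt_of_le_of_ne (hc i₀ hi₀) (Ne.symm hne))
        exact_mod_cast this
      have h1 : ∏ i, x i ^ (k i).toNat = 0 :=
        Finset.prod_eq_zero (Finset.mem_univ i₀) (by rw [hxi, zero_pow]; omega)
      rw [h1] at hprod
      obtain ⟨i, -, hi⟩ := Finset.prod_eq_zero_iff.1 hprod.symm
      obtain ⟨hi0, hki0⟩ := pow_eq_zero_iff'.1 hi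
      have : (0 : ℚ) ≤ k i := by
        rw [hz _ hi0]
        exact mul_nonneg hN'.le (hc i (by simp [hi0]))
      have : 0 ≤ k i := by exact_mod_cast this
      omega)
  -- On the support, `log (x i)` is a `ℚ`-linear function of `(v i, 1)`.
  obtain ⟨L, hL⟩ := exists_linearMap_apply_eq (K := ℚ)
    (fun i : {i // x i ≠ 0} => homogenize (v i)) (fun i => Real.log (x i)) (by
      intro b hb
      obtain ⟨N, hN, k, hk, hprod⟩ := prod_pow_toNat_eq_of_relation (fun i : {i // x i ≠ 0} => v i)
        (fun i => x i) (by
          intro m m' h1 h2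
          -- Exponents on the support, extended by zero.
          let e : ({i // x i ≠ 0} → ℕ) → ι → ℕ := fun m i => if hi : x i ≠ 0 then m ⟨i, hi⟩ else 0
          have h := hrel (e m) (e m')
          simp only [← Fintype.sum_subtype_add_sum_subtype (fun i => x i ≠ 0),
            ← Fintype.prod_subtype_mul_prod_subtype (fun i => x i ≠ 0)] at h
          have e1 : ∀ (m : {i // x i ≠ 0} → ℕ) (i : {i // x i ≠ 0}), e m i = m i :=
            fun m i => dif_pos i.2
          have e2 : ∀ (m : {i // x i ≠ 0} → ℕ) (i : {i // ¬ x i ≠ 0}), e m i = 0 :=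
            fun m i => dif_neg i.2
          simp only [e1, e2, zero_smul, pow_zero, Finset.sum_const_zero, add_zero,
            Finset.prod_const_one, mul_one] at h
          exact h h1 h2) b hb
      have hlog := congrArg Real.log hprod
      rw [Real.log_prod (fun i _ => pow_ne_zero _ i.2),
        Real.log_prod (fun i _ => pow_ne_zero _ i.2), ← sub_eq_zero,
        ← Finset.sum_sub_distrib] at hlog
      have hN' : (N : ℝ) ≠ 0 := by exact_mod_cast hN.ne'
      refine (mul_eq_zero.1 ?_).resolve_left hN'
      refine Eq.trans ?_ hlog
      rw [Finset.mul_sum]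
      refine Finset.sum_congr rfl fun i _ => ?_
      have h1 : ((k i : ℤ) : ℝ) = N * (b i : ℝ) := by exact_mod_cast hk i
      have h2 : (((k i).toNat : ℤ) : ℝ) - (((-k i).toNat : ℤ) : ℝ) = k i := by
        exact_mod_cast Int.toNat_sub_toNat_neg (k i)
      rw [Real.log_pow, Real.log_pow, ← sub_mul, Rat.smul_def, ← mul_assoc, ← h1, ← h2,
        Int.cast_natCast, Int.cast_natCast])
  refine ⟨fun j => -(φ (Pi.single j 1, 0) : ℚ), (φ (0, 1) : ℚ),
    fun j => Real.exp (L (Pi.single j 1, 0)), Real.exp (L (0, 1)),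
    fun j => Real.exp_pos _, Real.exp_pos _, fun i => ?_⟩
  have hdot : dot (fun j => -((φ (Pi.single j 1, 0) : ℚ) : ℝ)) (v i)
      = ((φ (0, 1) : ℚ) : ℝ) - ((φ (homogenize (v i)) : ℚ) : ℝ) := by
    rw [linearMap_homogenize]
    push_cast [dot, smul_eq_mul]
    simp [mul_comm]
  rw [hdot]
  refine ⟨fun hi => ?_, fun hi => ⟨?_, ?_⟩⟩
  · have : ((0 : ℚ) : ℝ) < (φ (homogenize (v i)) : ℚ) := by
      exact_mod_cast hφ i (by simp [hi])
    simpa using this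
  · rw [hφW _ (Submodule.subset_span ⟨⟨i, hi⟩, rfl⟩)]
    simp
  · have h := hL ⟨i, hi⟩
    rw [linearMap_homogenize] at h
    rw [← Real.exp_log (lt_of_le_of_ne (hx i) hi.symm), ← h, Real.exp_add, mul_comm,
      Real.exp_sum]
    congr 1
    refine Finset.prod_congr rfl fun j _ => ?_
    rw [← Real.exp_nat_mul, Rat.smul_def]
    simp

end ToricPoints

/-! ### Generators of the ring of bounded elements -/

section Generators

variable {n : ℕ}

open MvPolynomial

theorem add_mem_nonnegPolys {p q : MvPolynomial (Fin n) ℝ} (hp : p ∈ nonnegPolys n)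
    (hq : q ∈ nonnegPolys n) : p + q ∈ nonnegPolys n := fun α => by
  rw [coeff_add]
  exact add_nonneg (hp α) (hq α)

theorem mul_mem_nonnegPolys {p q : MvPolynomial (Fin n) ℝ} (hp : p ∈ nonnegPolys n)
    (hq : q ∈ nonnegPolys n) : p * q ∈ nonnegPolys n := fun α => by
  classical
  rw [coeff_mul]
  exact Finset.sum_nonneg fun k _ => mul_nonneg (hp _) (hq _)

theorem monomial_mem_nonnegPolys (α : Fin n →₀ ℕ) {c : ℝ} (hc : 0 ≤ c) :
    monomial α c ∈ nonnegPolys n := fun β => by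
  classical
  rw [coeff_monomial]
  split_ifs <;> simp [hc]

theorem pow_mem_nonnegPolys {p : MvPolynomial (Fin n) ℝ} (hp : p ∈ nonnegPolys n) (k : ℕ) :
    p ^ k ∈ nonnegPolys n := by
  induction k with
  | zero => exact monomial_mem_nonnegPolys 0 zero_le_one
  | succ k ih => exact pow_succ p k ▸ mul_mem_nonnegPolys ih hp

variable {g : MvPolynomial (Fin n) ℝ}

/-- Every element of `T_g` is a fraction `f / g ^ k` with `f` in `ℝ_{≥0}[X]`. -/
theorem exists_eq_div_pow_of_mem_localizedSemiring (hg : g ≠ 0) (hg0 : g ∈ nonnegPolys n)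
    {t : localizedRing g} (ht : t ∈ localizedSemiring g) :
    ∃ f ∈ nonnegPolys n, ∃ k : ℕ, (t : RatFun n) = toRat f / toRat g ^ k := by
  have hG := toRat_ne_zero hg
  induction ht using Subsemiring.closure_induction with
  | mem t ht =>
    rcases ht with ⟨f, hf, h⟩ | h
    · exact ⟨f, hf, 0, by simpa using h⟩
    · exact ⟨1, monomial_mem_nonnegPolys 0 zero_le_one, 1, by simpa using h⟩
  | zero => exact ⟨0, fun α => by simp, 0, by simp⟩
  | one => exact ⟨1, monomial_mem_nonnegPolys 0 zero_le_one, 0, by simp⟩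
  | add s t _ _ hs ht =>
    obtain ⟨p, hp, k, hk⟩ := hs
    obtain ⟨q, hq, l, hl⟩ := ht
    refine ⟨p * g ^ l + q * g ^ k, add_mem_nonnegPolys
      (mul_mem_nonnegPolys hp (pow_mem_nonnegPolys hg0 l))
      (mul_mem_nonnegPolys hq (pow_mem_nonnegPolys hg0 k)), k + l, ?_⟩
    rw [Subring.coe_add, hk, hl]
    simp only [map_add, map_mul, map_pow]
    field_simp
    ring
  | mul s t _ _ hs ht =>
    obtain ⟨p, hp, k, hk⟩ := hs
    obtain ⟨q, hq, l, hl⟩ := ht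
    refine ⟨p * q, mul_mem_nonnegPolys hp hq, k + l, ?_⟩
    rw [Subring.coe_mul, hk, hl, map_mul, pow_add]
    field_simp

/-- The real constants, as elements of `A(g)`. -/
noncomputable def boundedConst (g : MvPolynomial (Fin n) ℝ) : ℝ →+* boundedRing g :=
  ((toRat.comp C).codRestrict (localizedRing g) fun c =>
    Subring.subset_closure (Or.inl ⟨C c, rfl⟩)).codRestrict (boundedRing g) fun c => by
      obtain ⟨N, hN⟩ := exists_nat_ge |c|
      obtain ⟨h1, h2⟩ := abs_le.1 hN
      refine ⟨N, Subsemiring.subset_closure (Or.inl ⟨C (N + c), ?_, ?_⟩),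
        Subsemiring.subset_closure (Or.inl ⟨C (N - c), ?_, ?_⟩)⟩
      · exact monomial_mem_nonnegPolys 0 (by linarith)
      · simp [RingHom.codRestrict]
      · exact monomial_mem_nonnegPolys 0 (by linarith)
      · simp [RingHom.codRestrict]

@[simp]
theorem coe_boundedConst (c : ℝ) :
    ((boundedConst g c : localizedRing g) : RatFun n) = toRat (C c) := rfl

theorem div_mem_localizedRing (f : MvPolynomial (Fin n) ℝ) :
    toRat f / toRat g ∈ localizedRing g := by
  rw [div_eq_mul_inv]
  exact mul_mem (Subring.subset_closure (Or.inl ⟨f, rfl⟩)) (Subring.subset_closure (Or.inr rfl))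

theorem div_mem_localizedSemiring {f : MvPolynomial (Fin n) ℝ} (hf : f ∈ nonnegPolys n)
    {t : localizedRing g} (ht : (t : RatFun n) = toRat f / toRat g) :
    t ∈ localizedSemiring g := by
  have h1 : toRat f ∈ localizedRing g := Subring.subset_closure (Or.inl ⟨f, rfl⟩)
  have h2 : (toRat g)⁻¹ ∈ localizedRing g := Subring.subset_closure (Or.inr rfl)
  have e : t = ⟨toRat f, h1⟩ * ⟨(toRat g)⁻¹, h2⟩ := Subtype.ext (by simp [ht, div_eq_mul_inv])
  rw [e]
  exact mul_mem (Subsemiring.subset_closure (Or.inl ⟨f, hf, rfl⟩))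
    (Subsemiring.subset_closure (Or.inr rfl))

/-- For `α` occurring in `g`, the fraction `X^α / g` is `T_g`-bounded: `N * g ± X^α` has nonnegative
coefficients as soon as `N` is at least the inverse of the coefficient of `X^α` in `g`. -/
theorem monomial_div_mem_boundedRing (hg : g ≠ 0) (hg0 : g ∈ nonnegPolys n) {α : Fin n →₀ ℕ}
    (hα : α ∈ g.support) :
    (⟨toRat (monomial α 1) / toRat g, div_mem_localizedRing _⟩ : localizedRing g)
      ∈ boundedRing g := by
  classical
  have hG := toRat_ne_zero hg
  have hpos : 0 < g.coeff α := lt_of_le_of_ne (hg0 α) (Ne.symm (mem_support_iff.1 hα))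
  obtain ⟨N, hN⟩ := exists_nat_ge (g.coeff α)⁻¹
  have hN1 : 1 ≤ N * g.coeff α := by
    rwa [← div_le_iff₀ hpos, one_div]
  refine ⟨N, div_mem_localizedSemiring (f := (N : MvPolynomial (Fin n) ℝ) * g + monomial α 1) ?_ ?_,
    div_mem_localizedSemiring (f := (N : MvPolynomial (Fin n) ℝ) * g - monomial α 1) ?_ ?_⟩
  · intro β
    rw [coeff_add, ← map_natCast (C (σ := Fin n) (R := ℝ)), coeff_C_mul]
    exact add_nonneg (mul_nonneg (Nat.cast_nonneg _) (hg0 β))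
      (monomial_mem_nonnegPolys α zero_le_one β)
  · simp
    field_simp
  · intro β
    rw [coeff_sub, ← map_natCast (C (σ := Fin n) (R := ℝ)), coeff_C_mul, coeff_monomial]
    split_ifs with h
    · rw [← h]
      linarith
    · simpa using mul_nonneg (Nat.cast_nonneg N) (hg0 β)
  · simp
    field_simp

/-- The element `X^α / g` of `A(g)`, for an exponent `α` occurring in `g`. -/
noncomputable def boundedMonomial (hg : g ≠ 0) (hg0 : g ∈ nonnegPolys n) (α : g.support) :
    boundedRing g :=
  ⟨_, monomial_div_mem_boundedRing hg hg0 α.2⟩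

theorem coe_boundedMonomial (hg : g ≠ 0) (hg0 : g ∈ nonnegPolys n) (α : g.support) :
    ((boundedMonomial hg hg0 α : localizedRing g) : RatFun n)
      = toRat (monomial (α : Fin n →₀ ℕ) 1) / toRat g := rfl

theorem boundedRing_ext {a b : boundedRing g}
    (h : ((a : localizedRing g) : RatFun n) = ((b : localizedRing g) : RatFun n)) : a = b :=
  Subtype.ext (Subtype.ext h)

/-- `A(g)` is generated as a ring by the constants and the fractions `X^α / g`, `α` occurring in `g`.
Indeed, boundedness of `a` forces `a + N = f / g ^ m` where the monomials of `f` are among those of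
`g ^ m`, and each of these is a product of `m` monomials of `g`. -/
theorem eq_top_of_generators_mem (hg : g ≠ 0) (hg0 : g ∈ nonnegPolys n)
    (R : Subring (boundedRing g)) (hC : ∀ c, boundedConst g c ∈ R)
    (hM : ∀ α, boundedMonomial hg hg0 α ∈ R) : R = ⊤ := by
  classical
  have hG := toRat_ne_zero hg
  have hpow : ∀ (m : ℕ), ∀ α ∈ (g ^ m).support,
      ∃ b ∈ R, ((b : localizedRing g) : RatFun n) = toRat (monomial α 1) / toRat g ^ m := by
    intro m
    induction m with
    | zero =>
      intro α hα
      have h : α = 0 := by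
        by_contra h
        rw [pow_zero, mem_support_iff, coeff_one, if_neg (Ne.symm h)] at hα
        exact hα rfl
      exact ⟨1, R.one_mem, by simp [h]⟩
    | succ m ih =>
      intro α hα
      rw [pow_succ] at hα
      obtain ⟨β, hβ, γ, hγ, rfl⟩ := Finset.mem_add.1 (support_mul _ _ hα)
      obtain ⟨b, hb, e⟩ := ih β hβ
      refine ⟨b * boundedMonomial hg hg0 ⟨γ, hγ⟩, R.mul_mem hb (hM _), ?_⟩
      rw [Subring.coe_mul, Subring.coe_mul, e, coe_boundedMonomial, div_mul_div_comm, ← map_mul,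
        monomial_mul, one_mul, pow_succ]
  refine eq_top_iff.2 fun a _ => ?_
  obtain ⟨N, h1, h2⟩ := a.2
  obtain ⟨p, hp, k, hk⟩ := exists_eq_div_pow_of_mem_localizedSemiring hg hg0 h1
  obtain ⟨q, hq, l, hl⟩ := exists_eq_div_pow_of_mem_localizedSemiring hg hg0 h2
  have hk' : (N : RatFun n) + ((a : localizedRing g) : RatFun n) = toRat p / toRat g ^ k := by
    simpa using hk
  have hl' : (N : RatFun n) - ((a : localizedRing g) : RatFun n) = toRat q / toRat g ^ l := by
    simpa using hl
  have hsum : p * g ^ l + q * g ^ k = C (2 * N : ℝ) * g ^ (k + l) := by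
    apply IsFractionRing.injective (MvPolynomial (Fin n) ℝ) (RatFun n)
    have h : toRat p / toRat g ^ k + toRat q / toRat g ^ l = 2 * N := by
      rw [← hk', ← hl']
      ring
    rw [div_add_div _ _ (pow_ne_zero _ hG) (pow_ne_zero _ hG),
      div_eq_iff (mul_ne_zero (pow_ne_zero _ hG) (pow_ne_zero _ hG))] at h
    simp only [map_add, map_mul, map_pow, map_natCast, map_ofNat]
    rw [pow_add, ← h]
    ring
  -- No cancellation takes place in a sum of polynomials with nonnegative coefficients.
  have hsupp : (p * g ^ l).support ⊆ (g ^ (k + l)).support := by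
    intro α hα
    rw [mem_support_iff] at hα ⊢
    intro h0
    have h := congrArg (coeff α) hsum
    rw [coeff_C_mul, h0, mul_zero, coeff_add] at h
    have h3 := mul_mem_nonnegPolys hp (pow_mem_nonnegPolys hg0 l) α
    have h4 := mul_mem_nonnegPolys hq (pow_mem_nonnegPolys hg0 k) α
    exact hα (by linarith)
  choose! b hbR hb using hpow (k + l)
  have ha : a = ∑ α ∈ (p * g ^ l).support,
      boundedConst g ((p * g ^ l).coeff α) * b α - boundedConst g N := by
    apply boundedRing_ext
    have e : toRat (p * g ^ l) / toRat g ^ (k + l) = ∑ α ∈ (p * g ^ l).support,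
        toRat (C ((p * g ^ l).coeff α)) * (toRat (monomial α 1) / toRat g ^ (k + l)) := by
      conv_lhs => rw [(p * g ^ l).as_sum, map_sum, Finset.sum_div]
      refine Finset.sum_congr rfl fun α _ => ?_
      rw [← mul_div_assoc, ← map_mul, C_mul_monomial, mul_one]
    have e2 : ((a : localizedRing g) : RatFun n) = toRat (p * g ^ l) / toRat g ^ (k + l) - N := by
      rw [eq_sub_iff_add_eq, add_comm, hk', map_mul, map_pow, pow_add,
        mul_div_mul_right _ _ (pow_ne_zero _ hG)]
    rw [e2, e]
    push_cast
    simp only [coe_boundedConst]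
    rw [Finset.sum_congr rfl fun α hα => by rw [← hb α (hsupp hα)]]
    simp
  rw [ha]
  exact R.sub_mem (R.sum_mem fun α hα => R.mul_mem (hC _) (hbR α (hsupp hα))) (hC _)

end Generators

/-! ### Values of the places `λ_w` -/

section Values

variable {n : ℕ} {r s : RatFun n} {y : Fin n → ℝ} {c d : ℝ}

theorem HasValueAt.add (hr : HasValueAt r y c) (hs : HasValueAt s y d) :
    HasValueAt (r + s) y (c + d) := by
  obtain ⟨p, q, hq, rfl, rfl⟩ := hr
  obtain ⟨p', q', hq', rfl, rfl⟩ := hs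
  have h0 : q ≠ 0 := by rintro rfl; simp at hq
  have h0' : q' ≠ 0 := by rintro rfl; simp at hq'
  refine ⟨p * q' + q * p', q * q', by simp [hq, hq'], ?_, ?_⟩
  · rw [div_add_div _ _ (toRat_ne_zero h0) (toRat_ne_zero h0')]
    simp only [map_add, map_mul]
  · rw [div_add_div _ _ hq hq']
    simp only [map_add, map_mul]

theorem HasValueAt.mul (hr : HasValueAt r y c) (hs : HasValueAt s y d) :
    HasValueAt (r * s) y (c * d) := by
  obtain ⟨p, q, hq, rfl, rfl⟩ := hr
  obtain ⟨p', q', hq', rfl, rfl⟩ := hs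
  refine ⟨p * p', q * q', by simp [hq, hq'], ?_, ?_⟩ <;>
  simp only [map_mul, div_mul_div_comm]

/-- The rational function `r` lies in `O_w`, and `λ_w(r)` is defined at `y` with value `c`. -/
def HasPlaceValueAt (w : Fin n → ℝ) (r : RatFun n) (y : Fin n → ℝ) (c : ℝ) : Prop :=
  ∃ h : r ∈ valuationRing w, HasValueAt (place w ⟨r, h⟩) y c

variable {w : Fin n → ℝ}

theorem HasPlaceValueAt.add (hr : HasPlaceValueAt w r y c) (hs : HasPlaceValueAt w s y d) :
    HasPlaceValueAt w (r + s) y (c + d) := by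
  obtain ⟨h, hr⟩ := hr
  obtain ⟨h', hs⟩ := hs
  have e := map_add (place w) ⟨r, h⟩ ⟨s, h'⟩
  exact ⟨add_mem h h', (e ▸ hr.add hs :)⟩

theorem HasPlaceValueAt.mul (hr : HasPlaceValueAt w r y c) (hs : HasPlaceValueAt w s y d) :
    HasPlaceValueAt w (r * s) y (c * d) := by
  obtain ⟨h, hr⟩ := hr
  obtain ⟨h', hs⟩ := hs
  have e := map_mul (place w) ⟨r, h⟩ ⟨s, h'⟩
  exact ⟨mul_mem h h', (e ▸ hr.mul hs :)⟩

/-- If `q` has maximal weight `e` and all monomials of `p` have weight at most `e`, then `λ_w(p/q)` is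
the quotient of the parts of weight `e`; this covers both cases of the definition of `λ_w`. -/
theorem hasPlaceValueAt_div {e : ℝ} {p q : MvPolynomial (Fin n) ℝ}
    (hq : polyVal w q = ((-e : ℝ) : WithTop ℝ)) (hp : ((-e : ℝ) : WithTop ℝ) ≤ polyVal w p)
    (hy : MvPolynomial.eval y (weightPart w e q) ≠ 0) :
    HasPlaceValueAt w (toRat p / toRat q) y
      (MvPolynomial.eval y (weightPart w e p) / MvPolynomial.eval y (weightPart w e q)) := by
  have hq0 : q ≠ 0 := by
    rintro rfl
    rw [polyVal_zero] at hq
    exact WithTop.top_ne_coe hq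
  have h := (div_mem_valuationRing w p hq0).2 (hq ▸ hp)
  exact ⟨h, _, _, hy, by rw [place_div w hq0 h, placeFormula_eq w hq (hq ▸ hp)], rfl⟩

theorem polyVal_monomial (w : Fin n → ℝ) (α : Fin n →₀ ℕ) (c : ℝ) :
    ((-dot w α : ℝ) : WithTop ℝ) ≤ polyVal w (MvPolynomial.monomial α c) := by
  classical
  refine (le_polyVal_iff w _ _).2 fun β hβ => ?_
  rw [MvPolynomial.coeff_monomial] at hβ
  rw [(ite_ne_right_iff.1 hβ).1]

open Classical in
theorem weightPart_monomial (w : Fin n → ℝ) (d : ℝ) (α : Fin n →₀ ℕ) (c : ℝ) :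
    weightPart w d (MvPolynomial.monomial α c)
      = if dot w α = d then MvPolynomial.monomial α c else 0 := by
  ext β
  rw [coeff_weightPart, apply_ite (MvPolynomial.coeff β), MvPolynomial.coeff_monomial,
    MvPolynomial.coeff_zero]
  by_cases h : α = β
  · simp [h]
  · simp [h]

theorem dot_zero (w : Fin n → ℝ) : dot w 0 = 0 := by simp [dot]

theorem hasPlaceValueAt_C (w y : Fin n → ℝ) (c : ℝ) :
    HasPlaceValueAt w (toRat (MvPolynomial.C c)) y c := by
  have hC : ∀ b : ℝ, weightPart w 0 (MvPolynomial.C b) = MvPolynomial.C b := fun b => by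
    rw [MvPolynomial.C_apply, weightPart_monomial, if_pos (dot_zero w)]
  have h := hasPlaceValueAt_div (w := w) (y := y) (e := 0) (p := MvPolynomial.C c)
    (q := MvPolynomial.C 1) (by simp [polyVal_one])
    (by simpa [dot_zero] using polyVal_monomial w 0 c) (by rw [hC]; simp)
  rw [hC, hC] at h
  simpa using h

/-- The elements `a` of `A(g)` that lie in `O_w` and satisfy `λ_w(a)(y) = x(a)`, as a subring. -/
def placeValueSubring {g : MvPolynomial (Fin n) ℝ} (w y : Fin n → ℝ) (x : boundedRing g →+* ℝ) :
    Subring (boundedRing g) where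
  carrier := {a | HasPlaceValueAt w ((a : localizedRing g) : RatFun n) y (x a)}
  zero_mem' := by simpa using hasPlaceValueAt_C w y 0
  one_mem' := by simpa using hasPlaceValueAt_C w y 1
  neg_mem' := by
    intro a ha
    simpa using (hasPlaceValueAt_C w y (-1)).mul ha
  add_mem' := by
    intro a b ha hb
    simpa using HasPlaceValueAt.add ha hb
  mul_mem' := by
    intro a b ha hb
    simpa using HasPlaceValueAt.mul ha hb

end Values

/-! ### Real points of the ring of bounded elements -/

section Points

variable {n : ℕ} {g : MvPolynomial (Fin n) ℝ}

open MvPolynomial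

/-- A ring homomorphism `A(g) → ℝ` fixes the constants, as `ℝ` has no other ring endomorphism. -/
theorem map_boundedConst (x : boundedRing g →+* ℝ) (c : ℝ) : x (boundedConst g c) = c :=
  congrArg (fun f : ℝ →+* ℝ => f c)
    (Subsingleton.elim (x.comp (boundedConst g)) (RingHom.id ℝ))

theorem sum_coeff_mul_boundedMonomial (hg : g ≠ 0) (hg0 : g ∈ nonnegPolys n) :
    ∑ α : g.support, boundedConst g (g.coeff α) * boundedMonomial hg hg0 α = 1 := by
  apply boundedRing_ext
  push_cast
  simp only [coe_boundedConst, coe_boundedMonomial, ← mul_div_assoc, ← map_mul, C_mul_monomial,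
    mul_one]
  rw [← Finset.sum_div, ← map_sum, Finset.sum_coe_sort g.support fun α => monomial α (g.coeff α),
    ← g.as_sum, div_self (toRat_ne_zero hg)]

theorem prod_boundedMonomial_pow (hg : g ≠ 0) (hg0 : g ∈ nonnegPolys n) (m : g.support → ℕ) :
    (((∏ α, boundedMonomial hg hg0 α ^ m α : boundedRing g) : localizedRing g) : RatFun n)
      = toRat (monomial (∑ α, m α • (α : Fin n →₀ ℕ)) 1) / toRat g ^ ∑ α, m α := by
  push_cast
  simp only [coe_boundedMonomial, div_pow, Finset.prod_div_distrib, ← map_pow, monomial_pow,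
    one_pow, ← map_prod, Finset.prod_pow_eq_pow_sum, monomial_sum_one]

/-- Every point `x` of `S(T(g))` is given by a weight `w` and a positive point `y`: the values
`x(X^α / g)` determine both, and then `x` and `a ↦ λ_w(a)(y)` agree on generators of `A(g)`. -/
theorem exists_hasPlaceValueAt (hg : g ≠ 0) (hg0 : g ∈ nonnegPolys n)
    (x : boundedRing g →+* ℝ) (hx : x ∈ realPoints (boundedSemiring g)) :
    ∃ w y : Fin n → ℝ, (∀ j, 0 < y j) ∧
      ∀ a : boundedRing g, HasPlaceValueAt w ((a : localizedRing g) : RatFun n) y (x a) := by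
  classical
  let u := boundedMonomial hg hg0
  have hu : ∀ α, 0 ≤ x (u α) := fun α => hx _
    (div_mem_localizedSemiring (monomial_mem_nonnegPolys _ zero_le_one) rfl)
  obtain ⟨w, d, y, r, hy, -, hface⟩ := exists_weight_and_point
    (fun α : g.support => (α : Fin n →₀ ℕ)) (fun α => x (u α)) hu (by
      intro m m' h1 h2
      simp only [← map_pow, ← map_prod]
      congr 1
      apply boundedRing_ext
      rw [prod_boundedMonomial_pow, prod_boundedMonomial_pow, h1, h2])
  have hsum : ∑ α : g.support, g.coeff α * x (u α) = 1 := by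
    have h := congrArg x (sum_coeff_mul_boundedMonomial hg hg0)
    simpa only [map_sum, map_mul, map_boundedConst, map_one] using h
  have hle : ∀ α ∈ g.support, dot w α ≤ d := by
    intro α hα
    by_cases h : x (u ⟨α, hα⟩) = 0
    · exact ((hface ⟨α, hα⟩).1 h).le
    · exact ((hface ⟨α, hα⟩).2 h).1.le
  have hval : ∀ α : g.support, x (u α) = if dot w α = d then r * ∏ j, y j ^ (α : Fin n →₀ ℕ) j
      else 0 := by
    intro α
    by_cases h : x (u α) = 0
    · rw [if_neg ((hface α).1 h).ne, h]
    · rw [if_pos ((hface α).2 h).1, ← ((hface α).2 h).2]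
  -- Applying `x` to `∑ c_α X^α / g = 1` shows that the constant `r` is `1 / in_w(g)(y)`.
  have heval : r * eval y (weightPart w d g) = 1 := by
    rw [← hsum, weightPart, map_sum, Finset.sum_filter, Finset.mul_sum,
      ← Finset.sum_coe_sort g.support]
    refine Finset.sum_congr rfl fun α _ => ?_
    rw [hval]
    split_ifs
    · rw [eval_monomial, Finsupp.prod_fintype _ _ (by simp)]
      ring
    · simp
  have hg_val : polyVal w g = ((-d : ℝ) : WithTop ℝ) := by
    refine polyVal_eq_of w ((le_polyVal_iff w d g).2 fun α hα => hle α (mem_support_iff.2 hα)) ?_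
    intro h
    rw [h] at heval
    simp at heval
  refine ⟨w, y, hy, fun a => ?_⟩
  have htop := eq_top_of_generators_mem hg hg0 (placeValueSubring w y x) (fun c => ?_)
    (fun α => ?_)
  · exact (htop ▸ Subring.mem_top a : a ∈ placeValueSubring w y x)
  · change HasPlaceValueAt w _ y _
    rw [map_boundedConst]
    exact hasPlaceValueAt_C w y c
  · have h := hasPlaceValueAt_div (y := y) hg_val
      (le_trans (by exact_mod_cast neg_le_neg (hle _ α.2)) (polyVal_monomial w α 1))
      (right_ne_zero_of_mul_eq_one heval)
    rw [weightPart_monomial, div_eq_mul_inv (eval y _), ← eq_inv_of_mul_eq_one_left heval] at h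
    change HasPlaceValueAt w _ y (x (u α))
    rw [hval]
    convert h using 1
    · rfl
    split_ifs
    · rw [eval_monomial, Finsupp.prod_fintype _ _ (by simp)]
      ring
    · simp

end Points

end Handelman

theorem theorem4p1 (n : ℕ) (g : MvPolynomial (Fin n) ℝ) (hg : g ≠ 0)
    (hg_nonneg : g ∈ Handelman.nonnegPolys n)
    (x : Handelman.boundedRing g →+* ℝ)
    (hx : x ∈ Handelman.realPoints (Handelman.boundedSemiring g)) :
    ∃ (w : Fin n → ℝ) (y : Fin n → ℝ), (∀ i, 0 < y i) ∧
      ∀ a : Handelman.boundedRing g,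
        ∃ h : ((a : Handelman.localizedRing g) : Handelman.RatFun n) ∈ Handelman.valuationRing w,
          Handelman.HasValueAt (Handelman.place w ⟨a, h⟩) y (x a) := by
  exact Handelman.exists_hasPlaceValueAt hg hg_nonneg x hx
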